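/- Let $\mathbb{K}$ be a field of characteristic zero, $S=\mathbb{K}[x_1,\ldots,x_n]$ ($n\ge 0$), and let $f\in S$ be a nonzero polynomial of degree $d$, not necessarily quasi-homogeneous. Write $f=c\,f_1^{e_1}\cdots f_r^{e_r}$ with $c\in\mathbb{K}^*$ and $f_1,\ldots,f_r$ irreducible and pairwise non-associated, and let $$D(f)=\{\delta\in \mathrm{Der}_{\mathbb{K}}(S) \mid \delta(f_i)\in f_i^{e_i}S \text{ for } i=1,\ldots,r\}$$ be the (generalized) logarithmic derivation module of $f$, viewed as a submodule of $S^n$ through $\sum_i a_i\partial_{x_i}\mapsto (a_1,\ldots,a_n)$. Let $S^h=S[h]$ with its standard grading ($\deg x_i=\deg h=1$), and grade $(S^h)^n=\bigoplus_i S^h\,\partial_{x_i}$ so that the vectors of the canonical basis have degree $0$. For $m\in S^n$, let $m^h\in (S^h)^n$ be its homogenization with respect to $h$: if $\deg m$ is the maximum of the degrees of the coordinates of $m$, and $m_k$ is the homogeneous part of degree $k$ of $m$, then $m^h=\sum_k h^{\deg m-k}\,m_k$. Put $$D(f)^h := S^h\langle m^h \mid m\in D(f)\rangle\subseteq (S^h)^n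 .$$ For a graded submodule $M\subseteq (S^h)^n$ with Hilbert--Poincaré series $HP_M(t)=\sum_i (\dim_{\mathbb{K}}M_i)\,t^i$ such that $(1-t)^{n+1}HP_M(t)$ is a polynomial, let $$\chi(M):=\big[(1-t)^{n+1}\,HP_M(t)\big]'(1)\in\mathbb{Z}.$$ Theorem. The module $D(f)^h$ is a graded submodule of $(S^h)^n$ with finite-dimensional homogeneous parts, $(1-t)^{n+1}HP_{D(f)^h}(t)$ is a polynomial with integer coefficients, and $\chi(D(f)^h)=d$. -/

import Mathlib

namespace LogDer

open MvPolynomial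

noncomputable section

section Derivations

variable {K σ : Type*} [Field K]

/-- `D(g; k)`: the `S`-module of the `K`-linear derivations `δ` of `S = K[x_i : i ∈ σ]` such that
`δ(g) = a * g ^ k` for some `a ∈ S`. -/
def logDerPow (g : MvPolynomial σ K) (k : ℕ) :
    Submodule (MvPolynomial σ K) (Derivation K (MvPolynomial σ K) (MvPolynomial σ K)) where
  carrier := {δ | ∃ a : MvPolynomial σ K, δ g = a * g ^ k}
  zero_mem' := ⟨0, by simp⟩
  add_mem' := by
    rintro δ ε ⟨a, ha⟩ ⟨b, hb⟩
    exact ⟨a + b, by rw [Derivation.add_apply, ha, hb, add_mul]⟩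
  smul_mem' := by
    rintro c δ ⟨a, ha⟩
    exact ⟨c * a, by rw [Derivation.smul_apply, ha, smul_eq_mul, mul_assoc]⟩

/-- The (generalized) logarithmic derivation module `D(f)` of a nonzero polynomial `f`: the
intersection of the modules `D(g; e)`, where `g` runs over the irreducible factors of `f` and `e` is
the multiplicity of `g` in `f`. (`D(g; e)` does not change if `g` is multiplied by a unit, that is
by a nonzero constant.) -/
def logDer (f : MvPolynomial σ K) :
    Submodule (MvPolynomial σ K) (Derivation K (MvPolynomial σ K) (MvPolynomial σ K)) :=
  ⨅ (g : MvPolynomial σ K) (_ : Irreducible g) (_ : g ∣ f), logDerPow g (multiplicity g f)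

/-- The identification of `Der_K(S)` with `S^σ` which sends `∑ a_i ∂_i` to `(a_i)_i`. -/
def derCoords :
    Derivation K (MvPolynomial σ K) (MvPolynomial σ K) ≃ₗ[MvPolynomial σ K]
      (σ → MvPolynomial σ K) where
  toFun δ i := δ (X i)
  map_add' _ _ := rfl
  map_smul' _ _ := rfl
  invFun a := mkDerivation K a
  left_inv δ := derivation_ext fun i => by simp [mkDerivation_X]
  right_inv a := by
    funext i
    simp [mkDerivation_X]

end Derivations

section Homogenization

variable {K σ ι : Type*} [Field K]

/-- The homogenization of the polynomial `p` in degree `N ≥ deg p`: the homogeneous part of degree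
`k` of `p` is multiplied by `h ^ (N - k)`. The ring `S^h = S[h]` is the polynomial ring with
variables indexed by `Option σ`; the variable `h` is `X none` and `x_i` is `X (some i)`. -/
def homogenizeTo (N : ℕ) (p : MvPolynomial σ K) : MvPolynomial (Option σ) K :=
  ∑ k ∈ Finset.range (N + 1), rename some (homogeneousComponent k p) * X none ^ (N - k)

/-- The degree of an element of `S^ι`, the maximum of the degrees of its coordinates. -/
def tupleDegree [Fintype ι] (m : ι → MvPolynomial σ K) : ℕ :=
  Finset.univ.sup fun j => (m j).totalDegree

/-- The homogenization `m^h ∈ (S^h)^ι` of `m ∈ S^ι`, the vectors of the canonical basis having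
degree zero. -/
def homogenizeTuple [Fintype ι] (m : ι → MvPolynomial σ K) : ι → MvPolynomial (Option σ) K :=
  fun j => homogenizeTo (tupleDegree m) (m j)

/-- The homogenization `M^h = S^h⟨m^h | m ∈ M⟩` of a submodule `M` of `S^ι`. -/
def homogenizeModule [Fintype ι] (M : Submodule (MvPolynomial σ K) (ι → MvPolynomial σ K)) :
    Submodule (MvPolynomial (Option σ) K) (ι → MvPolynomial (Option σ) K) :=
  Submodule.span (MvPolynomial (Option σ) K) (homogenizeTuple '' (M : Set (ι → MvPolynomial σ K)))

end Homogenization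

section HilbertSeries

variable {K τ ι : Type*} [Field K]

/-- A submodule `M` of the free module `R^ι`, `R = K[x_i : i ∈ τ]`, is graded if it contains the
homogeneous parts of its elements (the canonical basis of `R^ι` has degree zero). -/
def IsGradedSubmodule (M : Submodule (MvPolynomial τ K) (ι → MvPolynomial τ K)) : Prop :=
  ∀ m ∈ M, ∀ i : ℕ, (fun j => homogeneousComponent i (m j)) ∈ M

/-- The homogeneous part `M_i` of `M`. The parts of negative degree are zero. -/
def gradedPart (M : Submodule (MvPolynomial τ K) (ι → MvPolynomial τ K)) (i : ℕ) :
    Submodule K (ι → MvPolynomial τ K) :=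
  M.restrictScalars K ⊓ Submodule.pi Set.univ fun _ => homogeneousSubmodule τ K i

/-- The Hilbert-Poincaré series `∑ (dim_K M_i) t^i` of a graded submodule `M` of `R^ι`. -/
def hilbertPoincare (M : Submodule (MvPolynomial τ K) (ι → MvPolynomial τ K)) : PowerSeries ℤ :=
  PowerSeries.mk fun i => (Module.finrank K (gradedPart M i) : ℤ)

/-- `P` is the polynomial `(1 - t)^N * HP_M(t)`, where `N` is the number of variables of `R`. -/
def IsHilbertNumerator [Fintype τ] (M : Submodule (MvPolynomial τ K) (ι → MvPolynomial τ K))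
    (P : Polynomial ℤ) : Prop :=
  (P : PowerSeries ℤ) = (1 - PowerSeries.X) ^ Fintype.card τ * hilbertPoincare M

open Classical in
/-- The invariant `χ(M)`: the derivative at `t = 1` of the polynomial `(1 - t)^N * HP_M(t)`, where
`N` is the number of variables of `R` (and `0` if this series is not a polynomial). -/
def chi [Fintype τ] (M : Submodule (MvPolynomial τ K) (ι → MvPolynomial τ K)) : ℤ :=
  if hP : ∃ P : Polynomial ℤ, IsHilbertNumerator M P then
    (Polynomial.derivative hP.choose).eval 1
  else 0

/-- The value of `χ` may be computed with any polynomial equal to `(1 - t)^N * HP_M(t)`. -/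
theorem IsHilbertNumerator.chi_eq [Fintype τ]
    {M : Submodule (MvPolynomial τ K) (ι → MvPolynomial τ K)} {P : Polynomial ℤ}
    (hP : IsHilbertNumerator M P) : chi M = (Polynomial.derivative P).eval 1 := by
  have hex : ∃ P : Polynomial ℤ, IsHilbertNumerator M P := ⟨P, hP⟩
  have heq : hex.choose = P := by
    apply Polynomial.coe_injective
    exact hex.choose_spec.trans hP.symm
  rw [chi, dif_pos hex, heq]

end HilbertSeries

/-- The homogenized logarithmic derivation module `D(f)^h`, a submodule of
`S^h⟨∂_{x_1}, …, ∂_{x_n}⟩ = (S^h)^n`. -/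
def logDerHomogenized {K : Type*} [Field K] {n : ℕ} (f : MvPolynomial (Fin n) K) :
    Submodule (MvPolynomial (Option (Fin n)) K) (Fin n → MvPolynomial (Option (Fin n)) K) :=
  homogenizeModule ((logDer f).map
    (derCoords : _ ≃ₗ[MvPolynomial (Fin n) K] (Fin n → MvPolynomial (Fin n) K)).toLinearMap)

end

end LogDer

namespace LogDer

open MvPolynomial

noncomputable section

/-! ### Hilbert–Serre rationality for graded submodules of a free module. -/

section HilbertSerre

variable {K τ ι : Type*} [Field K]

/-! Write `f = c ∏ f_i ^ e_i` and `w_j = ∑_i (∂_j f_i) ∏_{k ≠ i} f_k ^ e_k`. By the Chinese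
remainder theorem, `D(f)` is the kernel of `S^n → S/fS`, `a ↦ ∑ a_j w_j`
(`exists_mem_logDer_iff_dvd`). Each `w_j` is zero or of degree at most `d - 1`, and in
characteristic zero no irreducible factor of `f` divides all the `w_j`.

Dehomogenization identifies the degree `i` part of `D(f)^h` with the elements of `D(f)` of degree at
most `i` (`finrank_gradedPart_homogenizeModule`). Hence its codimension `a_i` in the degree `i` part
of `(S^h)^n` is the dimension of the image of `(S_{≤ i})^n` in `S/fS`. This image lies in the image
of `S_{≤ i+d-1}`. It contains the image of `u S_{≤ i}`, where `u` is a general `K`-combination of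
the `w_j`; as `u` is prime to `f`, multiplication by `u` is injective on `S/fS`. So `a_i` lies
between the values at `i` and `i + d - 1` of the Hilbert function of `S^h/(f^h)`
(`exists_finrank_boundedPart_add`).

If `P` is the numerator of `D(f)^h`, which exists by Hilbert–Serre (`exists_isHilbertNumerator`),
these bounds make `(n - P) - (1 - t^d)` and `(1 - t^d) - t^(d-1) (n - P)` nonnegative on `(0, 1)`.
At `t = 1` this gives `P(1) = n`, so both polynomials vanish there, and their derivatives, being
nonpositive, give `P'(1) ≥ d` and `P'(1) ≤ d` (`eval_one_derivative_eq_of_bounds`). -/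

theorem homogeneousComponent_X_mul_zero (v : τ) (p : MvPolynomial τ K) :
    homogeneousComponent 0 (X v * p) = 0 := by
  classical simp [homogeneousComponent_zero, coeff_X_mul']

theorem homogeneousComponent_X_mul_succ (v : τ) (p : MvPolynomial τ K) (i : ℕ) :
    homogeneousComponent (i + 1) (X v * p) = X v * homogeneousComponent i p := by
  classical
  ext m
  rw [coeff_homogeneousComponent, coeff_X_mul', coeff_X_mul', coeff_homogeneousComponent]
  by_cases hv : v ∈ m.support
  · have hle : Finsupp.single v 1 ≤ m := by
      rw [Finsupp.single_le_iff]
      exact Nat.one_le_iff_ne_zero.2 (Finsupp.mem_support_iff.1 hv)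
    have hdeg : m.degree = (m - Finsupp.single v 1).degree + 1 := by
      conv_lhs => rw [← tsub_add_cancel_of_le hle]
      simp
    simp [hv, hdeg]
  · simp [hv]

theorem mem_gradedPart {M : Submodule (MvPolynomial τ K) (ι → MvPolynomial τ K)} {i : ℕ}
    {m : ι → MvPolynomial τ K} :
    m ∈ gradedPart M i ↔ m ∈ M ∧ ∀ j, (m j).IsHomogeneous i := by
  simp [gradedPart]

instance finiteDimensional_homogeneousSubmodule [Finite τ] (i : ℕ) :
    FiniteDimensional K (homogeneousSubmodule τ K i) :=
  Module.Finite.iff_fg.2 (homogeneousSubmodule_fg τ K i)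

instance finiteDimensional_gradedPart [Finite τ] [Finite ι]
    (M : Submodule (MvPolynomial τ K) (ι → MvPolynomial τ K)) (i : ℕ) :
    FiniteDimensional K (gradedPart M i) := by
  let e : gradedPart M i →ₗ[K] (ι → homogeneousSubmodule τ K i) :=
    LinearMap.pi fun j => ((LinearMap.proj j).comp (gradedPart M i).subtype).codRestrict _
      fun m => (mem_gradedPart.1 m.2).2 j
  refine FiniteDimensional.of_injective e fun a b h => Subtype.ext (funext fun j => ?_)
  exact congrArg Subtype.val (congrFun h j)

/-- The submodule `{b ∈ B | X_v b ∈ A}`. -/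
def colonVar (A B : Submodule (MvPolynomial τ K) (ι → MvPolynomial τ K)) (v : τ) :
    Submodule (MvPolynomial τ K) (ι → MvPolynomial τ K) :=
  B ⊓ A.comap (LinearMap.lsmul (MvPolynomial τ K) _ (X v))

/-- The submodule `A + X_v B`. -/
def addVarMul (A B : Submodule (MvPolynomial τ K) (ι → MvPolynomial τ K)) (v : τ) :
    Submodule (MvPolynomial τ K) (ι → MvPolynomial τ K) :=
  A ⊔ B.map (LinearMap.lsmul (MvPolynomial τ K) _ (X v))

theorem mem_colonVar {A B : Submodule (MvPolynomial τ K) (ι → MvPolynomial τ K)} {v : τ}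
    {m : ι → MvPolynomial τ K} : m ∈ colonVar A B v ↔ m ∈ B ∧ (X v : MvPolynomial τ K) • m ∈ A :=
  Iff.rfl

theorem mem_addVarMul {A B : Submodule (MvPolynomial τ K) (ι → MvPolynomial τ K)} {v : τ}
    {m : ι → MvPolynomial τ K} :
    m ∈ addVarMul A B v ↔ ∃ a ∈ A, ∃ b ∈ B, a + (X v : MvPolynomial τ K) • b = m := by
  simp [addVarMul, Submodule.mem_sup]

theorem isGradedSubmodule_colonVar {A B : Submodule (MvPolynomial τ K) (ι → MvPolynomial τ K)}
    (hA : IsGradedSubmodule A) (hB : IsGradedSubmodule B) (v : τ) :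
    IsGradedSubmodule (colonVar A B v) := by
  intro m hm i
  rw [mem_colonVar] at hm ⊢
  refine ⟨hB m hm.1 i, ?_⟩
  convert hA _ hm.2 (i + 1) using 1
  funext j
  simp [homogeneousComponent_X_mul_succ]

theorem isGradedSubmodule_addVarMul {A B : Submodule (MvPolynomial τ K) (ι → MvPolynomial τ K)}
    (hA : IsGradedSubmodule A) (hB : IsGradedSubmodule B) (v : τ) :
    IsGradedSubmodule (addVarMul A B v) := by
  intro m hm i
  rw [mem_addVarMul] at hm ⊢
  obtain ⟨a, ha, b, hb, rfl⟩ := hm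
  refine ⟨_, hA a ha i, ?_⟩
  cases i with
  | zero => exact ⟨0, zero_mem _, by classical funext j; simp [coeff_X_mul']⟩
  | succ i => exact ⟨_, hB b hb i, by funext j; simp [homogeneousComponent_X_mul_succ]⟩

theorem gradedPart_addVarMul_zero {A B : Submodule (MvPolynomial τ K) (ι → MvPolynomial τ K)}
    (hA : IsGradedSubmodule A) (v : τ) :
    gradedPart (addVarMul A B v) 0 = gradedPart A 0 := by
  ext m
  simp only [mem_gradedPart, mem_addVarMul]
  refine ⟨?_, fun h => ⟨⟨m, h.1, 0, zero_mem _, by simp⟩, h.2⟩⟩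
  rintro ⟨⟨a, ha, b, hb, rfl⟩, h⟩
  refine ⟨?_, h⟩
  convert hA a ha 0 using 1
  funext j
  rw [← homogeneousComponent_eq_self (h j), Pi.add_apply, Pi.smul_apply, smul_eq_mul, map_add,
    homogeneousComponent_X_mul_zero, add_zero]

/-- Multiplication by `X_v` as a `K`-linear map. -/
def mulVar (K : Type*) {τ : Type*} (ι : Type*) [Field K] (v : τ) :
    (ι → MvPolynomial τ K) →ₗ[K] (ι → MvPolynomial τ K) :=
  (LinearMap.lsmul (MvPolynomial τ K) (ι → MvPolynomial τ K) (X v)).restrictScalars K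

theorem mulVar_apply (v : τ) (m : ι → MvPolynomial τ K) :
    mulVar K ι v m = (X v : MvPolynomial τ K) • m := rfl

theorem mulVar_injective (v : τ) : Function.Injective (mulVar K ι v) := by
  intro a b h
  funext j
  have := congrFun h j
  simpa [mulVar_apply] using this

theorem finrank_map_mulVar [Finite τ] [Finite ι] (v : τ) (V : Submodule K (ι → MvPolynomial τ K)) :
    Module.finrank K (V.map (mulVar K ι v)) = Module.finrank K V :=
  (Submodule.equivMapOfInjective _ (mulVar_injective v) V).finrank_eq.symm

theorem gradedPart_addVarMul_succ {A B : Submodule (MvPolynomial τ K) (ι → MvPolynomial τ K)}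
    (hA : IsGradedSubmodule A) (hB : IsGradedSubmodule B) (v : τ) (i : ℕ) :
    gradedPart (addVarMul A B v) (i + 1) =
      gradedPart A (i + 1) ⊔ (gradedPart B i).map (mulVar K ι v) := by
  ext m
  simp only [mem_gradedPart, mem_addVarMul, Submodule.mem_sup, Submodule.mem_map]
  constructor
  · rintro ⟨⟨a, ha, b, hb, rfl⟩, h⟩
    refine ⟨_, ⟨hA a ha (i + 1), fun j => homogeneousComponent_isHomogeneous _ _⟩, _,
      ⟨_, ⟨hB b hb i, fun j => homogeneousComponent_isHomogeneous _ _⟩, rfl⟩, ?_⟩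
    funext j
    rw [← homogeneousComponent_eq_self (h j)]
    simp [homogeneousComponent_X_mul_succ, mulVar_apply]
  · rintro ⟨a, ha, _, ⟨b, hb, rfl⟩, rfl⟩
    refine ⟨⟨a, ha.1, b, hb.1, rfl⟩, fun j => (ha.2 j).add ?_⟩
    have := (isHomogeneous_X K v).mul (hb.2 j)
    rwa [add_comm 1 i] at this

theorem gradedPart_inf_map_mulVar {A B : Submodule (MvPolynomial τ K) (ι → MvPolynomial τ K)}
    (v : τ) (i : ℕ) :
    gradedPart A (i + 1) ⊓ (gradedPart B i).map (mulVar K ι v) =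
      (gradedPart (colonVar A B v) i).map (mulVar K ι v) := by
  ext m
  simp only [Submodule.mem_inf, Submodule.mem_map, mem_gradedPart, mem_colonVar]
  constructor
  · rintro ⟨ha, b, hb, rfl⟩
    exact ⟨b, ⟨⟨hb.1, ha.1⟩, hb.2⟩, rfl⟩
  · rintro ⟨b, hb, rfl⟩
    refine ⟨⟨hb.1.2, fun j => ?_⟩, b, ⟨hb.1.1, hb.2⟩, rfl⟩
    have := (isHomogeneous_X K v).mul (hb.2 j)
    rwa [add_comm 1 i] at this

theorem finrank_gradedPart_addVarMul [Finite τ] [Finite ι]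
    {A B : Submodule (MvPolynomial τ K) (ι → MvPolynomial τ K)}
    (hA : IsGradedSubmodule A) (hB : IsGradedSubmodule B) (v : τ) (i : ℕ) :
    Module.finrank K (gradedPart (addVarMul A B v) (i + 1)) +
        Module.finrank K (gradedPart (colonVar A B v) i) =
      Module.finrank K (gradedPart A (i + 1)) + Module.finrank K (gradedPart B i) := by
  rw [gradedPart_addVarMul_succ hA hB, ← finrank_map_mulVar v (gradedPart (colonVar A B v) i),
    ← gradedPart_inf_map_mulVar, Submodule.finrank_sup_add_finrank_inf_eq, finrank_map_mulVar]

/-- Additivity of dimension along multiplication by `X_v` on `B/A`: its kernel is `colonVar A B v /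
A`, its cokernel `B / addVarMul A B v`. -/
theorem hilbertPoincare_addVarMul [Finite τ] [Finite ι]
    {A B : Submodule (MvPolynomial τ K) (ι → MvPolynomial τ K)}
    (hA : IsGradedSubmodule A) (hB : IsGradedSubmodule B) (v : τ) :
    (1 - PowerSeries.X) * (hilbertPoincare B - hilbertPoincare A) =
      (hilbertPoincare B - hilbertPoincare (addVarMul A B v)) -
        PowerSeries.X * (hilbertPoincare (colonVar A B v) - hilbertPoincare A) := by
  have key : hilbertPoincare (addVarMul A B v) + PowerSeries.X * hilbertPoincare (colonVar A B v) =
      hilbertPoincare A + PowerSeries.X * hilbertPoincare B := by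
    ext i
    cases i with
    | zero =>
      simp only [map_add, PowerSeries.coeff_zero_X_mul, hilbertPoincare, PowerSeries.coeff_mk]
      rw [gradedPart_addVarMul_zero hA]
    | succ i =>
      simp only [map_add, PowerSeries.coeff_succ_X_mul, hilbertPoincare, PowerSeries.coeff_mk]
      exact_mod_cast finrank_gradedPart_addVarMul hA hB v i
  linear_combination key

/-- Since every variable kills `B/A`, the quotient is spanned over `K` by the classes of finitely
many generators of `B`; `D` bounds their degrees. -/
theorem exists_sub_mem_totalDegree_le [Finite τ] [Finite ι]
    (A B : Submodule (MvPolynomial τ K) (ι → MvPolynomial τ K))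
    (h : ∀ v : τ, ∀ b ∈ B, (X v : MvPolynomial τ K) • b ∈ A) :
    ∃ D : ℕ, ∀ b ∈ B, ∃ a ∈ A, ∀ j, (b j - a j).totalDegree ≤ D := by
  classical
  cases nonempty_fintype ι
  obtain ⟨G, rfl⟩ := IsNoetherian.noetherian B
  refine ⟨G.sup fun g => Finset.univ.sup fun j => (g j).totalDegree, fun b hb => ?_⟩
  induction hb using Submodule.span_induction with
  | mem g hg =>
    refine ⟨0, zero_mem _, fun j => ?_⟩
    simp only [Pi.zero_apply, sub_zero]
    exact (Finset.le_sup (f := fun j => (g j).totalDegree) (Finset.mem_univ j)).trans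
      (Finset.le_sup (f := fun g => Finset.univ.sup fun j => (g j).totalDegree) hg)
  | zero => exact ⟨0, zero_mem _, fun j => by simp⟩
  | add x y _ _ hx hy =>
    obtain ⟨a, ha, hx⟩ := hx
    obtain ⟨c, hc, hy⟩ := hy
    refine ⟨a + c, add_mem ha hc, fun j => ?_⟩
    have : (x + y) j - (a + c) j = (x j - a j) + (y j - c j) := by simp; ring
    rw [this]
    exact (totalDegree_add _ _).trans (max_le (hx j) (hy j))
  | smul r x hxB hx =>
    -- Constants preserve the degree bound, while a coefficient divisible by a variable sends `x`
    -- into `A`, leaving difference zero.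
    induction r using MvPolynomial.induction_on with
    | C c =>
      obtain ⟨a, ha, hx⟩ := hx
      refine ⟨(C c : MvPolynomial τ K) • a, A.smul_mem _ ha, fun j => ?_⟩
      have : ((C c : MvPolynomial τ K) • x) j - ((C c : MvPolynomial τ K) • a) j =
        c • (x j - a j) := by simp [C_mul', smul_sub]
      rw [this]
      exact (totalDegree_smul_le _ _).trans (hx j)
    | add p q hp hq =>
      obtain ⟨a, ha, hp⟩ := hp
      obtain ⟨c, hc, hq⟩ := hq
      refine ⟨a + c, add_mem ha hc, fun j => ?_⟩
      have : ((p + q) • x) j - (a + c) j = ((p • x) j - a j) + ((q • x) j - c j) := by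
        simp; ring
      rw [this]
      exact (totalDegree_add _ _).trans (max_le (hp j) (hq j))
    | mul_X p v _ =>
      refine ⟨(p * X v) • x, ?_, fun j => by simp⟩
      rw [mul_comm, mul_smul]
      exact h v _ (Submodule.smul_mem _ _ hxB)

/-- Above degree `D`, a homogeneous `b` equals the degree `i` component of its approximation in `A`,
which is in `A` by gradedness. -/
theorem exists_gradedPart_eq [Finite τ] [Finite ι]
    {A B : Submodule (MvPolynomial τ K) (ι → MvPolynomial τ K)} (hA : IsGradedSubmodule A)
    (hAB : A ≤ B) (h : ∀ v : τ, ∀ b ∈ B, (X v : MvPolynomial τ K) • b ∈ A) :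
    ∃ D : ℕ, ∀ i, D < i → gradedPart B i = gradedPart A i := by
  obtain ⟨D, hD⟩ := exists_sub_mem_totalDegree_le A B h
  refine ⟨D, fun i hi => le_antisymm (fun b hb => ?_) fun a ha => ?_⟩
  · rw [mem_gradedPart] at hb ⊢
    obtain ⟨a, ha, hab⟩ := hD b hb.1
    refine ⟨?_, hb.2⟩
    convert hA a ha i using 1
    funext j
    have := homogeneousComponent_eq_zero i (b j - a j) ((hab j).trans_lt hi)
    rw [map_sub, sub_eq_zero, homogeneousComponent_eq_self (hb.2 j)] at this
    exact this
  · rw [mem_gradedPart] at ha ⊢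
    exact ⟨hAB ha.1, ha.2⟩

/-- The Hilbert-Serre theorem for a subquotient of `R^ι` killed by the variables outside `s`. -/
theorem exists_polynomial_eq_hilbertPoincare_sub [Finite τ] [Finite ι] (s : Finset τ) :
    ∀ A B : Submodule (MvPolynomial τ K) (ι → MvPolynomial τ K), IsGradedSubmodule A →
      IsGradedSubmodule B → A ≤ B →
      (∀ v ∉ s, ∀ b ∈ B, (X v : MvPolynomial τ K) • b ∈ A) →
      ∃ Q : Polynomial ℤ, (Q : PowerSeries ℤ) =
        (1 - PowerSeries.X) ^ s.card * (hilbertPoincare B - hilbertPoincare A) := by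
  classical
  induction s using Finset.induction_on with
  | empty =>
    intro A B hA hB hAB h
    obtain ⟨D, hD⟩ := exists_gradedPart_eq hA hAB fun v => h v (by simp)
    refine ⟨(hilbertPoincare B - hilbertPoincare A).trunc (D + 1), ?_⟩
    ext i
    rw [Polynomial.coeff_coe, PowerSeries.coeff_trunc]
    split_ifs with hi
    · simp
    · rw [Finset.card_empty, pow_zero, one_mul, map_sub, hilbertPoincare, hilbertPoincare, PowerSeries.coeff_mk, PowerSeries.coeff_mk,
        hD i (by omega), sub_self]
  | insert v s hv ih =>
    intro A B hA hB hAB h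
    -- The kernel and cokernel of `X_v` on `B/A` are killed by `X_v` too, so the induction
    -- hypothesis for `s` applies to both.
    have hE : ∀ b ∈ B, (X v : MvPolynomial τ K) • b ∈ addVarMul A B v :=
      fun b hb => mem_addVarMul.2 ⟨0, zero_mem _, b, hb, zero_add _⟩
    have hAE : A ≤ addVarMul A B v := le_sup_left
    obtain ⟨Q₁, h₁⟩ := ih (addVarMul A B v) B (isGradedSubmodule_addVarMul hA hB v) hB
      (fun m hm => by
        obtain ⟨a, ha, b, hb, rfl⟩ := mem_addVarMul.1 hm
        exact add_mem (hAB ha) (B.smul_mem _ hb))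
      (fun u hu b hb => by
        by_cases huv : u = v
        · exact huv ▸ hE b hb
        · exact hAE (h u (by simp [huv, hu]) b hb))
    obtain ⟨Q₂, h₂⟩ := ih A (colonVar A B v) hA (isGradedSubmodule_colonVar hA hB v)
      (fun a ha => mem_colonVar.2 ⟨hAB ha, A.smul_mem _ ha⟩)
      (fun u hu b hb => by
        by_cases huv : u = v
        · exact huv ▸ (mem_colonVar.1 hb).2
        · exact h u (by simp [huv, hu]) b (mem_colonVar.1 hb).1)
    refine ⟨Q₁ - Polynomial.X * Q₂, ?_⟩
    rw [Finset.card_insert_of_notMem hv, pow_succ, mul_assoc, hilbertPoincare_addVarMul hA hB v]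
    simp only [Polynomial.coe_sub, Polynomial.coe_mul, Polynomial.coe_X, h₁, h₂]
    ring

/-- The Hilbert-Serre theorem for graded submodules of a free module over a polynomial ring. -/
theorem exists_isHilbertNumerator [Fintype τ] [Finite ι]
    {M : Submodule (MvPolynomial τ K) (ι → MvPolynomial τ K)} (hM : IsGradedSubmodule M) :
    ∃ P : Polynomial ℤ, IsHilbertNumerator M P := by
  obtain ⟨Q, hQ⟩ := exists_polynomial_eq_hilbertPoincare_sub Finset.univ ⊥ M
    (fun m hm i => by
      rw [Submodule.mem_bot] at hm ⊢
      subst hm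
      funext j
      simp)
    hM bot_le (fun v hv => absurd (Finset.mem_univ v) hv)
  refine ⟨Q, ?_⟩
  have h0 : hilbertPoincare (⊥ : Submodule (MvPolynomial τ K) (ι → MvPolynomial τ K)) = 0 := by
    ext i
    have : gradedPart (⊥ : Submodule (MvPolynomial τ K) (ι → MvPolynomial τ K)) i = ⊥ := by
      ext m
      rw [mem_gradedPart, Submodule.mem_bot, Submodule.mem_bot]
      refine ⟨fun h => h.1, fun h => ⟨h, fun j => ?_⟩⟩
      simpa [h] using isHomogeneous_zero τ K i
    simp [hilbertPoincare, this]
  rw [IsHilbertNumerator, hQ, h0, sub_zero, Finset.card_univ]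

end HilbertSerre

/-! ### Positivity at `t = 1` from nonnegative coefficients. -/

section NonnegativeSeries

theorem hasSum_congr_fun {f g : ℕ → ℝ} {v : ℝ} (hf : HasSum f v) (h : ∀ i, g i = f i) :
    HasSum g v :=
  funext h ▸ hf

/-- Multiplication by a polynomial multiplies the sum of a power series by its value. -/
theorem hasSum_coeff_coe_mul {t : ℝ} {b : PowerSeries ℤ} {v : ℝ}
    (hb : HasSum (fun i => ((PowerSeries.coeff i b : ℤ) : ℝ) * t ^ i) v) (p : Polynomial ℤ) :
    HasSum (fun i => ((PowerSeries.coeff i ((p : PowerSeries ℤ) * b) : ℤ) : ℝ) * t ^ i)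
      (Polynomial.aeval t p * v) := by
  induction p using Polynomial.induction_on' with
  | add p q hp hq =>
    convert hp.add hq using 1
    · funext i
      simp [add_mul]
    · simp [add_mul]
  | monomial k c =>
    have h1 : HasSum (fun i => ((PowerSeries.coeff (i + k)
        (((Polynomial.monomial k c : Polynomial ℤ) : PowerSeries ℤ) * b) : ℤ) : ℝ) * t ^ (i + k))
        (c * t ^ k * v) := by
      refine hasSum_congr_fun (hb.mul_left (c * t ^ k)) fun i => ?_
      have : PowerSeries.coeff (i + k)
          (((Polynomial.monomial k c : Polynomial ℤ) : PowerSeries ℤ) * b) =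
          c * PowerSeries.coeff i b := by
        rw [← Polynomial.C_mul_X_pow_eq_monomial, Polynomial.coe_mul, Polynomial.coe_pow,
          Polynomial.coe_X, Polynomial.coe_C, mul_assoc, PowerSeries.coeff_C_mul,
          PowerSeries.coeff_X_pow_mul]
      rw [this]
      push_cast
      ring
    have h2 := (hasSum_nat_add_iff (f := fun i => ((PowerSeries.coeff i
        (((Polynomial.monomial k c : Polynomial ℤ) : PowerSeries ℤ) * b) : ℤ) : ℝ) * t ^ i) k).1 h1
    rw [Finset.sum_eq_zero, add_zero] at h2
    · simpa [Polynomial.aeval_monomial] using h2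
    · intro i hi
      rw [← Polynomial.C_mul_X_pow_eq_monomial, Polynomial.coe_mul, Polynomial.coe_pow,
        Polynomial.coe_X, Polynomial.coe_C, mul_assoc, PowerSeries.coeff_C_mul,
        PowerSeries.coeff_X_pow_mul']
      simp [Finset.mem_range.1 hi]

/-- As `1/(1-t)^(n+1)` converges on `[0, 1)`, so does the series `b`, with sum `p(t)/(1-t)^(n+1)`;
its terms are nonnegative. -/
theorem aeval_nonneg_of_coe_eq_one_sub_pow_mul {p : Polynomial ℤ} {b : PowerSeries ℤ} {n : ℕ}
    (hp : (p : PowerSeries ℤ) = (1 - PowerSeries.X) ^ (n + 1) * b)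
    (hb : ∀ i, 0 ≤ PowerSeries.coeff i b) {t : ℝ} (h0 : 0 ≤ t) (h1 : t < 1) :
    0 ≤ Polynomial.aeval t p := by
  have hb' : (p : PowerSeries ℤ) * PowerSeries.mk (fun i => ((n + i).choose n : ℤ)) = b := by
    rw [hp, mul_comm, ← mul_assoc, PowerSeries.mk_add_choose_mul_one_sub_pow_eq_one, one_mul]
  have hs := hasSum_choose_mul_geometric_of_norm_lt_one n
    (show ‖t‖ < 1 by rwa [Real.norm_of_nonneg h0])
  have hs' : HasSum (fun i => ((PowerSeries.coeff i
      (PowerSeries.mk (fun i => ((n + i).choose n : ℤ))) : ℤ) : ℝ) * t ^ i) (1 / (1 - t) ^ (n + 1)) := by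
    refine hasSum_congr_fun hs fun i => ?_
    simp [add_comm n i]
  have h := hasSum_coeff_coe_mul hs' p
  rw [hb'] at h
  have hpos : 0 < 1 / (1 - t) ^ (n + 1) := by
    have : 0 < 1 - t := by linarith
    positivity
  refine nonneg_of_mul_nonneg_left (h.nonneg fun i => ?_) hpos
  exact mul_nonneg (by exact_mod_cast hb i) (pow_nonneg h0 i)

theorem eval_one_nonneg_of_aeval_nonneg {p : Polynomial ℤ}
    (hp : ∀ t : ℝ, 0 < t → t < 1 → 0 ≤ Polynomial.aeval t p) : 0 ≤ p.eval 1 := by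
  have hc : Filter.Tendsto (fun t : ℝ => Polynomial.aeval t p) (nhdsWithin 1 (Set.Iio 1))
      (nhds (Polynomial.aeval 1 p)) :=
    (Polynomial.continuous_aeval p).continuousAt.tendsto.mono_left nhdsWithin_le_nhds
  have h : (0 : ℝ) ≤ Polynomial.aeval (1 : ℝ) p := by
    refine ge_of_tendsto hc ?_
    filter_upwards [Ioo_mem_nhdsLT (show (0 : ℝ) < 1 by norm_num)] with t ht
    exact hp t ht.1 ht.2
  have h2 : Polynomial.aeval (1 : ℝ) p = ((p.eval 1 : ℤ) : ℝ) := by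
    simpa using Polynomial.aeval_algebraMap_apply ℝ (1 : ℤ) p
  rw [h2] at h
  exact_mod_cast h

/-- Write `p = (t - 1) q`: then `-q` is nonnegative on `(0, 1)`, hence at `1` by continuity, and
`p'(1) = q(1)`. -/
theorem eval_one_derivative_nonpos_of_aeval_nonneg {p : Polynomial ℤ}
    (hp : ∀ t : ℝ, 0 < t → t < 1 → 0 ≤ Polynomial.aeval t p) (h1 : p.eval 1 = 0) :
    (Polynomial.derivative p).eval 1 ≤ 0 := by
  obtain ⟨q, rfl⟩ := Polynomial.dvd_iff_isRoot.2 h1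
  have h : (0 : ℤ) ≤ (-q).eval 1 := by
    refine eval_one_nonneg_of_aeval_nonneg fun t h0 h1 => ?_
    have h := hp t h0 h1
    simp only [map_mul, map_sub, Polynomial.aeval_X, map_one] at h
    rw [map_neg]
    nlinarith
  simpa using h

end NonnegativeSeries

/-! ### Homogenization, dehomogenization and the affine Hilbert function. -/

section Dehomogenization

variable {K σ ι : Type*} [Field K]

/-- Dehomogenization `S[h] → S`, `h ↦ 1`. -/
def dehom (K σ : Type*) [Field K] : MvPolynomial (Option σ) K →ₐ[K] MvPolynomial σ K :=
  aeval fun o => o.elim 1 X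

theorem dehom_X_none : dehom K σ (X none) = 1 := by simp [dehom]

theorem dehom_rename (p : MvPolynomial σ K) : dehom K σ (rename some p) = p := by
  rw [dehom, aeval_rename]
  exact aeval_X_left_apply p

/-- Homogenization in degree `N` as a linear map. -/
def homogenizeToLinear (K σ : Type*) [Field K] (N : ℕ) :
    MvPolynomial σ K →ₗ[K] MvPolynomial (Option σ) K where
  toFun := homogenizeTo N
  map_add' p q := by simp [homogenizeTo, add_mul, Finset.sum_add_distrib]
  map_smul' c p := by simp [homogenizeTo, Finset.smul_sum]

theorem homogenizeToLinear_apply (N : ℕ) (p : MvPolynomial σ K) :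
    homogenizeToLinear K σ N p = homogenizeTo N p := rfl

theorem isHomogeneous_homogenizeTo (N : ℕ) (p : MvPolynomial σ K) :
    (homogenizeTo N p).IsHomogeneous N := by
  refine IsHomogeneous.sum _ _ _ fun k hk => ?_
  have hk : k ≤ N := Nat.lt_succ_iff.1 (Finset.mem_range.1 hk)
  have := (homogeneousComponent_isHomogeneous k p).rename_isHomogeneous (f := some)|>.mul
    (isHomogeneous_X_pow (R := K) (none : Option σ) (N - k))
  rwa [Nat.add_sub_cancel' hk] at this

theorem sum_range_homogeneousComponent {N : ℕ} {p : MvPolynomial σ K} (hp : p.totalDegree ≤ N) :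
    ∑ k ∈ Finset.range (N + 1), homogeneousComponent k p = p := by
  conv_rhs => rw [← sum_homogeneousComponent p]
  refine (Finset.sum_subset (Finset.range_subset_range.2 (by omega)) fun k _ hk => ?_).symm
  exact homogeneousComponent_eq_zero _ _ (by simpa using hk)

theorem dehom_homogenizeTo {N : ℕ} {p : MvPolynomial σ K} (hp : p.totalDegree ≤ N) :
    dehom K σ (homogenizeTo N p) = p := by
  simp only [homogenizeTo, map_sum, map_mul, map_pow, dehom_X_none, dehom_rename, one_pow, mul_one]
  exact sum_range_homogeneousComponent hp

theorem homogenizeTo_monomial {N : ℕ} {m : σ →₀ ℕ} (hm : m.degree ≤ N) (c : K) :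
    homogenizeTo N (monomial m c) =
      monomial (m.mapDomain some + Finsupp.single none (N - m.degree)) c := by
  have hmem : monomial m c ∈ homogeneousSubmodule σ K m.degree := isHomogeneous_monomial c rfl
  rw [homogenizeTo, Finset.sum_eq_single m.degree]
  · rw [homogeneousComponent_of_mem hmem, if_pos rfl, rename_monomial, X_pow_eq_monomial,
      monomial_mul, mul_one]
  · intro k _ hk
    rw [homogeneousComponent_of_mem hmem, if_neg hk, map_zero, zero_mul]
  · intro h
    exact absurd (Finset.mem_range.2 (Nat.lt_succ_of_le hm)) h

theorem dehom_monomial (m : σ →₀ ℕ) (k : ℕ) (c : K) :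
    dehom K σ (monomial (m.mapDomain some + Finsupp.single none k) c) = monomial m c := by
  have h : monomial (m.mapDomain some + Finsupp.single none k) c =
      rename some (monomial m c) * X none ^ k := by
    rw [rename_monomial, X_pow_eq_monomial, monomial_mul, mul_one]
  rw [h, map_mul, dehom_rename, map_pow, dehom_X_none, one_pow, mul_one]

theorem exists_eq_mapDomain_some_add_single (s : Option σ →₀ ℕ) :
    ∃ (m : σ →₀ ℕ) (k : ℕ), s = m.mapDomain some + Finsupp.single none k := by
  classical
  refine ⟨s.some, s none, ?_⟩
  ext o
  cases o with
  | none =>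
    rw [Finsupp.add_apply, Finsupp.mapDomain_of_notMem_range _ _ (by simp)]
    simp
  | some i =>
    rw [Finsupp.add_apply, Finsupp.mapDomain_apply (Option.some_injective _)]
    simp

theorem degree_mapDomain_some_add_single (m : σ →₀ ℕ) (k : ℕ) :
    (m.mapDomain some + Finsupp.single none k).degree = m.degree + k := by
  rw [map_add, Finsupp.degree_single, Finsupp.degree_mapDomain]

/-- It suffices to look at monomials: in degree `N`, the exponent of `h` is determined by the degree
of the remaining part. -/
theorem homogenizeTo_dehom_and_totalDegree_le {N : ℕ} {A : MvPolynomial (Option σ) K}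
    (hA : A.IsHomogeneous N) :
    homogenizeTo N (dehom K σ A) = A ∧ (dehom K σ A).totalDegree ≤ N := by
  have key : ∀ s ∈ A.support, homogenizeTo N (dehom K σ (monomial s (coeff s A))) =
      monomial s (coeff s A) ∧ (dehom K σ (monomial s (coeff s A))).totalDegree ≤ N := by
    intro s hs
    have hdeg : s.degree = N := by
      by_contra h
      exact (mem_support_iff.1 hs) (hA.coeff_eq_zero h)
    obtain ⟨m, k, hmk⟩ := exists_eq_mapDomain_some_add_single s
    have hN : m.degree + k = N := by rw [← degree_mapDomain_some_add_single, ← hmk, hdeg]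
    generalize coeff s A = c
    subst hmk
    rw [dehom_monomial, homogenizeTo_monomial (by omega)]
    refine ⟨by rw [show N - m.degree = k by omega], ?_⟩
    exact (isHomogeneous_monomial c rfl).totalDegree_le.trans (by omega)
  constructor
  · conv_rhs => rw [A.as_sum]
    conv_lhs => rw [A.as_sum]
    rw [← homogenizeToLinear_apply, map_sum, map_sum]
    exact Finset.sum_congr rfl fun s hs => (key s hs).1
  · conv_lhs => rw [A.as_sum]
    rw [map_sum]
    exact totalDegree_finsetSum_le fun s hs => (key s hs).2

/-- Both sides are forms of degree `N` with the same dehomogenization. -/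
theorem homogenizeTo_eq_X_pow_mul {N N' : ℕ} {p : MvPolynomial σ K} (hp : p.totalDegree ≤ N')
    (hN : N' ≤ N) : homogenizeTo N p = X none ^ (N - N') * homogenizeTo N' p := by
  have h1 : (X none ^ (N - N') * homogenizeTo N' p).IsHomogeneous N := by
    have := (isHomogeneous_X_pow (R := K) (none : Option σ) (N - N')).mul
      (isHomogeneous_homogenizeTo N' p)
    rwa [Nat.sub_add_cancel hN] at this
  rw [← (homogenizeTo_dehom_and_totalDegree_le h1).1, map_mul, map_pow, dehom_X_none, one_pow,
    one_mul, dehom_homogenizeTo hp]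

/-- The elements of degree at most `i` of a submodule of `S^ι`. -/
def boundedPart (M : Submodule (MvPolynomial σ K) (ι → MvPolynomial σ K)) (i : ℕ) :
    Submodule K (ι → MvPolynomial σ K) :=
  M.restrictScalars K ⊓ Submodule.pi Set.univ fun _ => restrictTotalDegree σ K i

theorem mem_boundedPart {M : Submodule (MvPolynomial σ K) (ι → MvPolynomial σ K)} {i : ℕ}
    {m : ι → MvPolynomial σ K} :
    m ∈ boundedPart M i ↔ m ∈ M ∧ ∀ j, (m j).totalDegree ≤ i := by
  simp [boundedPart, mem_restrictTotalDegree]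

variable [Fintype ι]

theorem totalDegree_le_tupleDegree (m : ι → MvPolynomial σ K) (j : ι) :
    (m j).totalDegree ≤ tupleDegree m :=
  Finset.le_sup (f := fun j => (m j).totalDegree) (Finset.mem_univ j)

theorem dehom_homogenizeTuple (m : ι → MvPolynomial σ K) :
    (fun j => dehom K σ (homogenizeTuple m j)) = m := by
  funext j
  rw [homogenizeTuple, dehom_homogenizeTo (totalDegree_le_tupleDegree m j)]

theorem dehom_mem_of_mem_homogenizeModule {M : Submodule (MvPolynomial σ K) (ι → MvPolynomial σ K)}
    {A : ι → MvPolynomial (Option σ) K} (hA : A ∈ homogenizeModule M) :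
    (fun j => dehom K σ (A j)) ∈ M := by
  induction hA using Submodule.span_induction with
  | mem x hx =>
    obtain ⟨m, hm, rfl⟩ := hx
    rwa [dehom_homogenizeTuple]
  | zero =>
    have h : (fun j : ι => dehom K σ ((0 : ι → MvPolynomial (Option σ) K) j)) = 0 :=
      funext fun j => map_zero _
    rw [h]
    exact M.zero_mem
  | add x y _ _ hx hy =>
    have h : (fun j => dehom K σ ((x + y) j)) =
        (fun j => dehom K σ (x j)) + fun j => dehom K σ (y j) :=
      funext fun j => map_add _ _ _
    rw [h]
    exact M.add_mem hx hy
  | smul r x _ hx =>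
    have h : (fun j => dehom K σ ((r • x) j)) = dehom K σ r • fun j => dehom K σ (x j) :=
      funext fun j => map_mul _ _ _
    rw [h]
    exact M.smul_mem _ hx

theorem homogenizeTo_mem_homogenizeModule
    {M : Submodule (MvPolynomial σ K) (ι → MvPolynomial σ K)} {m : ι → MvPolynomial σ K}
    (hm : m ∈ M) {i : ℕ} (hi : ∀ j, (m j).totalDegree ≤ i) :
    (fun j => homogenizeTo i (m j)) ∈ homogenizeModule M := by
  have h : (fun j => homogenizeTo i (m j)) =
      (X none ^ (i - tupleDegree m) : MvPolynomial (Option σ) K) • homogenizeTuple m := by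
    funext j
    exact homogenizeTo_eq_X_pow_mul (totalDegree_le_tupleDegree m j)
      (Finset.sup_le fun j _ => hi j)
  rw [h]
  exact Submodule.smul_mem _ _ (Submodule.subset_span ⟨m, hm, rfl⟩)

/-- Homogenization in degree exactly `i` is the isomorphism, with inverse `h ↦ 1`; elements of `M`
of smaller degree give multiples of `m^h` by powers of `h`. -/
theorem finrank_gradedPart_homogenizeModule
    (M : Submodule (MvPolynomial σ K) (ι → MvPolynomial σ K)) (i : ℕ) :
    Module.finrank K (gradedPart (homogenizeModule M) i) = Module.finrank K (boundedPart M i) := by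
  let H : (ι → MvPolynomial σ K) →ₗ[K] (ι → MvPolynomial (Option σ) K) :=
    LinearMap.pi fun j => (homogenizeToLinear K σ i).comp (LinearMap.proj j)
  have hH : ∀ m ∈ boundedPart M i, H m ∈ gradedPart (homogenizeModule M) i := by
    intro m hm
    rw [mem_boundedPart] at hm
    refine ⟨homogenizeTo_mem_homogenizeModule hm.1 hm.2, ?_⟩
    rw [SetLike.mem_coe, Submodule.mem_pi]
    exact fun j _ => isHomogeneous_homogenizeTo i (m j)
  refine (LinearEquiv.ofBijective (H.restrict hH) ⟨fun a b hab => ?_, fun A => ?_⟩).finrank_eq.symm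
  · refine Subtype.ext (funext fun j => ?_)
    have h : homogenizeTo i (a.1 j) = homogenizeTo i (b.1 j) :=
      congrFun (congrArg Subtype.val hab) j
    rw [← dehom_homogenizeTo ((mem_boundedPart.1 a.2).2 j), h,
      dehom_homogenizeTo ((mem_boundedPart.1 b.2).2 j)]
  · obtain ⟨h1, h2⟩ := (by simpa [gradedPart] using A.2 :
      A.1 ∈ homogenizeModule M ∧ ∀ j, (A.1 j).IsHomogeneous i)
    refine ⟨⟨fun j => dehom K σ (A.1 j), mem_boundedPart.2
      ⟨dehom_mem_of_mem_homogenizeModule h1,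
        fun j => (homogenizeTo_dehom_and_totalDegree_le (h2 j)).2⟩⟩, Subtype.ext (funext fun j => ?_)⟩
    exact (homogenizeTo_dehom_and_totalDegree_le (h2 j)).1

end Dehomogenization

/-! ### Logarithmic derivations as solutions of one congruence. -/

section LogDerEquation

variable {K σ : Type*} [Field K]

/-- Quantifying over all prime powers dividing `f` avoids multiplicities, so the condition splits
readily over coprime products. -/
theorem mem_logDer_iff {f : MvPolynomial σ K} (hf : f ≠ 0)
    {δ : Derivation K (MvPolynomial σ K) (MvPolynomial σ K)} :
    δ ∈ logDer f ↔ ∀ (g : MvPolynomial σ K) (k : ℕ), Irreducible g → g ^ k ∣ f → g ^ k ∣ δ g := by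
  simp only [logDer, Submodule.mem_iInf]
  constructor
  · intro h g k hg hk
    by_cases hk0 : k = 0
    · simp [hk0]
    · obtain ⟨a, ha⟩ := h g hg ((dvd_pow_self g hk0).trans hk)
      rw [ha]
      refine Dvd.dvd.mul_left (pow_dvd_pow g ?_) a
      exact ((FiniteMultiplicity.of_prime_left hg.prime hf).pow_dvd_iff_le_multiplicity).1 hk
  · intro h g hg _
    obtain ⟨a, ha⟩ := h g (multiplicity g f) hg (pow_multiplicity_dvd g f)
    exact ⟨a, by rw [ha, mul_comm]⟩

theorem derivation_apply_eq_sum [Fintype σ]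
    (δ : Derivation K (MvPolynomial σ K) (MvPolynomial σ K)) (p : MvPolynomial σ K) :
    δ p = ∑ j, δ (X j) * pderiv j p := by
  classical
  have hs : ∀ q, (∑ j, δ (X j) • pderiv j :
      Derivation K (MvPolynomial σ K) (MvPolynomial σ K)) q = ∑ j, δ (X j) * pderiv j q := by
    intro q
    have h := congrFun (map_sum Derivation.coeFnAddMonoidHom
      (fun j => δ (X j) • pderiv (R := K) j) Finset.univ) q
    exact h.trans (by rw [Finset.sum_apply]; rfl)
  have h : δ = ∑ j, δ (X j) • pderiv j := by
    refine derivation_ext fun i => ?_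
    rw [hs]
    simp [pderiv_X, Pi.single_apply]
  conv_lhs => rw [h]
  exact hs p

theorem pderiv_eq_zero_or_totalDegree_lt (p : MvPolynomial σ K) (j : σ) :
    pderiv j p = 0 ∨ (pderiv j p).totalDegree + 1 ≤ p.totalDegree := by
  have key : ∀ m ∈ (pderiv j p).support, (m.sum fun _ e => e) + 1 ≤ p.totalDegree := by
    intro m hm
    rw [mem_support_iff, coeff_pderiv] at hm
    have h := le_totalDegree (mem_support_iff.2 (left_ne_zero_of_mul hm))
    rw [Finsupp.sum_add_index' (fun _ => rfl) (fun _ _ _ => rfl),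
      Finsupp.sum_single_index rfl] at h
    exact h
  by_cases h0 : pderiv j p = 0
  · exact Or.inl h0
  · right
    obtain ⟨m, hm⟩ := support_nonempty.2 h0
    have hpos : 1 ≤ p.totalDegree := le_trans (Nat.le_add_left _ _) (key m hm)
    have : (pderiv j p).totalDegree ≤ p.totalDegree - 1 :=
      Finset.sup_le fun m hm => Nat.le_sub_of_add_le (key m hm)
    omega

theorem eq_C_of_pderiv_eq_zero [CharZero K] {p : MvPolynomial σ K} (h : ∀ j, pderiv j p = 0) :
    p = C (coeff 0 p) := by
  classical
  ext m
  rw [coeff_C]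
  split_ifs with hm
  · rw [hm]
  · obtain ⟨j, hj⟩ := Finsupp.ne_iff.1 (Ne.symm hm)
    have hle : Finsupp.single j 1 ≤ m := by
      rw [Finsupp.single_le_iff]
      exact Nat.one_le_iff_ne_zero.2 hj
    have hc := congrArg (coeff (m - Finsupp.single j 1)) (h j)
    rw [coeff_pderiv, tsub_add_cancel_of_le hle, coeff_zero] at hc
    refine (mul_eq_zero.1 hc).resolve_right ?_
    exact Nat.cast_add_one_ne_zero _

/-- For degree reasons `p` divides `∂_j p` only if `∂_j p = 0`; in characteristic zero, if this
holds for all `j` then `p` is constant. -/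
theorem exists_not_dvd_pderiv_of_irreducible [CharZero K] {p : MvPolynomial σ K}
    (hp : Irreducible p) : ∃ j, ¬ p ∣ pderiv j p := by
  by_contra! h
  have h0 : ∀ j, pderiv j p = 0 := by
    intro j
    rcases pderiv_eq_zero_or_totalDegree_lt p j with h1 | h1
    · exact h1
    · by_contra hne
      have := totalDegree_le_of_dvd_of_isDomain (h j) hne
      omega
  have hC := eq_C_of_pderiv_eq_zero h0
  refine hp.not_isUnit ?_
  rw [hC]
  refine (isUnit_iff_ne_zero.2 fun hc => hp.ne_zero ?_).map C
  rw [hC, hc, C_0]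

theorem pow_dvd_mul_iff_of_isRelPrime {x y g : MvPolynomial σ K} (hxy : IsRelPrime x y)
    (hg : Irreducible g) (k : ℕ) : g ^ k ∣ x * y ↔ g ^ k ∣ x ∨ g ^ k ∣ y := by
  refine ⟨fun h => ?_, fun h => h.elim (fun h => h.mul_right y) fun h => h.mul_left x⟩
  by_cases hgx : g ∣ x
  · exact Or.inl (hg.prime.pow_dvd_of_dvd_mul_right k
      (fun hgy => hg.not_isUnit (hxy hgx hgy)) h)
  · exact Or.inr (hg.prime.pow_dvd_of_dvd_mul_left k hgx h)

/-- Units are constants, so `δ` commutes with multiplication by them. -/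
theorem pow_dvd_apply_of_associated {p g : MvPolynomial σ K} (hgp : Associated p g) {k : ℕ}
    {δ : Derivation K (MvPolynomial σ K) (MvPolynomial σ K)} (h : p ^ k ∣ δ p) : g ^ k ∣ δ g := by
  obtain ⟨u, rfl⟩ := hgp
  obtain ⟨c, -, hc⟩ := isUnit_iff_eq_C_of_isReduced.1 u.isUnit
  have : δ (p * u) = u * δ p := by
    rw [hc, Derivation.leibniz, ← algebraMap_eq, Derivation.map_algebraMap]
    simp
  rw [this, mul_pow, mul_comm (p ^ k)]
  exact mul_dvd_mul ((u.isUnit.pow k).dvd) h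

theorem mul_dvd_add_iff_of_isRelPrime {x y a b : MvPolynomial σ K} (hxy : IsRelPrime x y) :
    x * y ∣ a * y + b * x ↔ x ∣ a ∧ y ∣ b := by
  constructor
  · intro h
    refine ⟨hxy.dvd_of_dvd_mul_right ?_, hxy.symm.dvd_of_dvd_mul_right ?_⟩
    · exact (dvd_add_left (Dvd.intro_left b rfl)).1 ((Dvd.intro y rfl).trans h)
    · exact (dvd_add_right (Dvd.intro_left a rfl)).1 ((Dvd.intro_left x rfl).trans h)
  · rintro ⟨⟨a, rfl⟩, ⟨b, rfl⟩⟩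
    exact ⟨a + b, by ring⟩

/-- The logarithmic derivations of `f` are the solutions of one linear congruence modulo `f`. -/
theorem exists_mem_logDer_iff_dvd [CharZero K] [Fintype σ] (f : MvPolynomial σ K) (hf : f ≠ 0) :
    ∃ w : σ → MvPolynomial σ K, (∀ j, w j = 0 ∨ (w j).totalDegree + 1 ≤ f.totalDegree) ∧
      (∀ g, Irreducible g → g ∣ f → ∃ j, ¬ g ∣ w j) ∧
      ∀ δ : Derivation K (MvPolynomial σ K) (MvPolynomial σ K),
        δ ∈ logDer f ↔ f ∣ ∑ j, δ (X j) * w j := by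
  revert hf
  induction f using UniqueFactorizationMonoid.induction_on_coprime with
  | h0 => exact fun h => absurd rfl h
  | h1 hx =>
    intro hf
    refine ⟨0, fun j => Or.inl rfl, fun g hg hgx => absurd (isUnit_of_dvd_unit hgx hx)
      hg.not_isUnit, fun δ => ?_⟩
    rw [mem_logDer_iff hf]
    refine iff_of_true (fun g k hg hk => ?_) hx.dvd
    exact (isUnit_of_dvd_unit hk hx).dvd
  | @hpr p e hp =>
    intro hf
    by_cases he : e = 0
    · subst he
      refine ⟨0, fun j => Or.inl rfl, fun g hg hgx => absurd (isUnit_of_dvd_unit hgx (by simp))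
        hg.not_isUnit, fun δ => ?_⟩
      rw [mem_logDer_iff hf]
      refine iff_of_true (fun g k hg hk => ?_) (by simp)
      exact (isUnit_of_dvd_unit hk (by simp)).dvd
    -- The condition is `δ p ≡ 0` modulo `p ^ e`, so the coefficients are the derivatives of `p`,
    -- not of `p ^ e`.
    · refine ⟨fun j => pderiv j p, fun j => ?_, fun g hg hgp => ?_, fun δ => ?_⟩
      · refine (pderiv_eq_zero_or_totalDegree_lt p j).imp_right fun h => h.trans ?_
        exact totalDegree_le_of_dvd_of_isDomain (dvd_pow_self p he) hf
      · obtain ⟨j, hj⟩ := exists_not_dvd_pderiv_of_irreducible hp.irreducible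
        have := (hg.prime.associated_of_dvd hp (hg.prime.dvd_of_dvd_pow hgp))
        exact ⟨j, fun h => hj (this.symm.dvd.trans h)⟩
      · rw [mem_logDer_iff hf, ← derivation_apply_eq_sum]
        refine ⟨fun h => h p e hp.irreducible dvd_rfl, fun h g k hg hk => ?_⟩
        by_cases hk0 : k = 0
        · simp [hk0]
        have hgp := hg.prime.associated_of_dvd hp
          (hg.prime.dvd_of_dvd_pow ((dvd_pow_self g hk0).trans hk))
        refine pow_dvd_apply_of_associated hgp.symm ((pow_dvd_pow p ?_).trans h)
        exact (pow_dvd_pow_iff hp.ne_zero hp.not_isUnit).1 ((hgp.symm.pow_pow.dvd).trans hk)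
  | @hcp x y hxy ihx ihy =>
    intro hf
    have hx0 := left_ne_zero_of_mul hf
    have hy0 := right_ne_zero_of_mul hf
    obtain ⟨w, hw1, hw2, hw3⟩ := ihx hx0
    obtain ⟨z, hz1, hz2, hz3⟩ := ihy hy0
    -- Chinese remainder: modulo `x` only the terms `w j * y` survive, and modulo `y` only `z j *
    -- x`; the cofactors are invisible to divisibility because `x` and `y` are coprime.
    refine ⟨fun j => w j * y + z j * x, fun j => ?_, fun g hg hgxy => ?_, fun δ => ?_⟩
    · rw [totalDegree_mul_of_isDomain hx0 hy0]
      show w j * y + z j * x = 0 ∨ (w j * y + z j * x).totalDegree + 1 ≤ _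
      rw [or_iff_not_imp_left]
      intro hne
      have h1 : w j * y = 0 ∨ (w j * y).totalDegree + 1 ≤ x.totalDegree + y.totalDegree := by
        rcases hw1 j with h | h
        · exact Or.inl (by rw [h, zero_mul])
        · have := totalDegree_mul (w j) y
          right
          omega
      have h2 : z j * x = 0 ∨ (z j * x).totalDegree + 1 ≤ x.totalDegree + y.totalDegree := by
        rcases hz1 j with h | h
        · exact Or.inl (by rw [h, zero_mul])
        · have := totalDegree_mul (z j) x
          right
          omega
      rcases h1 with h1 | h1 <;> rcases h2 with h2 | h2
      · exact absurd (by rw [h1, h2, add_zero]) hne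
      · rwa [h1, zero_add]
      · rwa [h2, add_zero]
      · have h3 := totalDegree_add (w j * y) (z j * x)
        have h4 := max_lt (Nat.lt_of_succ_le h1) (Nat.lt_of_succ_le h2)
        exact Nat.succ_le_of_lt (h3.trans_lt h4)
    · rcases hg.prime.dvd_or_dvd hgxy with hgx | hgy
      · obtain ⟨j, hj⟩ := hw2 g hg hgx
        refine ⟨j, fun h => ?_⟩
        rcases hg.prime.dvd_or_dvd ((dvd_add_left (hgx.mul_left _)).1 h) with h | h
        · exact hj h
        · exact hg.not_isUnit (hxy hgx h)
      · obtain ⟨j, hj⟩ := hz2 g hg hgy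
        refine ⟨j, fun h => ?_⟩
        rcases hg.prime.dvd_or_dvd ((dvd_add_right (hgy.mul_left _)).1 h) with h | h
        · exact hj h
        · exact hg.not_isUnit (hxy h hgy)
    · have hsum : ∑ j, δ (X j) * (w j * y + z j * x) =
          (∑ j, δ (X j) * w j) * y + (∑ j, δ (X j) * z j) * x := by
        rw [Finset.sum_mul, Finset.sum_mul, ← Finset.sum_add_distrib]
        exact Finset.sum_congr rfl fun j _ => by ring
      rw [hsum, mul_dvd_add_iff_of_isRelPrime hxy, ← hw3, ← hz3, mem_logDer_iff hf,
        mem_logDer_iff hx0, mem_logDer_iff hy0]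
      constructor
      · exact fun h => ⟨fun g k hg hk => h g k hg (hk.mul_right y),
          fun g k hg hk => h g k hg (hk.mul_left x)⟩
      · rintro ⟨h1, h2⟩ g k hg hk
        exact ((pow_dvd_mul_iff_of_isRelPrime hxy hg k).1 hk).elim (h1 g k hg) (h2 g k hg)

/-- A general linear combination of polynomials without a common factor with `f` is prime to
`f`. -/
theorem exists_isRelPrime_sum [Infinite K] [Fintype σ] {f : MvPolynomial σ K} (hf : f ≠ 0)
    {w : σ → MvPolynomial σ K} (hw : ∀ g, Irreducible g → g ∣ f → ∃ j, ¬ g ∣ w j) :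
    ∃ c : σ → K, IsRelPrime f (∑ j, C (c j) * w j) := by
  classical
  -- For each irreducible factor `g` of `f` the bad coefficient vectors form a proper subspace, and
  -- an infinite field admits no finite cover of `K^σ` by such subspaces.
  let V : MvPolynomial σ K → Submodule K (σ → K) := fun g =>
    { carrier := {c | g ∣ ∑ j, C (c j) * w j}
      zero_mem' := by simp
      add_mem' := by
        intro a b ha hb
        simpa [add_mul, Finset.sum_add_distrib] using dvd_add ha hb
      smul_mem' := by
        intro r a ha
        simpa [mul_assoc, Finset.mul_sum] using Dvd.dvd.mul_left ha (C r) }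
  have hV : ⊤ ∉ ((UniqueFactorizationMonoid.factors f).toFinset.image V) := by
    intro h
    obtain ⟨g, hg, hgV⟩ := Finset.mem_image.1 h
    rw [Multiset.mem_toFinset] at hg
    obtain ⟨j, hj⟩ := hw g (UniqueFactorizationMonoid.irreducible_of_factor g hg)
      (UniqueFactorizationMonoid.dvd_of_mem_factors hg)
    have : Pi.single j 1 ∈ V g := hgV ▸ Submodule.mem_top
    apply hj
    have h2 : g ∣ ∑ i, C ((Pi.single j 1 : σ → K) i) * w i := this
    rw [Finset.sum_eq_single j] at h2
    · simpa using h2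
    · intro i _ hi
      simp [hi]
    · simp
  have hne := Subspace.biUnion_ne_univ_of_top_notMem hV
  obtain ⟨c, hc⟩ := (Set.ne_univ_iff_exists_notMem _).1 hne
  refine ⟨c, ?_⟩
  refine WfDvdMonoid.isRelPrime_of_no_irreducible_factors (fun h => hf h.1) fun g hg hgf hgw => ?_
  obtain ⟨q, hq, hgq⟩ := UniqueFactorizationMonoid.exists_mem_factors_of_dvd hf hg hgf
  refine hc ?_
  simp only [Set.mem_iUnion]
  exact ⟨V q, Finset.mem_image.2 ⟨q, Multiset.mem_toFinset.2 hq, rfl⟩, hgq.symm.dvd.trans hgw⟩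

end LogDerEquation

/-! ### Gradedness of the homogenized module. -/

section Gradedness

variable {K σ ι : Type*} [Field K]

theorem homogeneousComponent_smul_mem {τ : Type*}
    {M : Submodule (MvPolynomial τ K) (ι → MvPolynomial τ K)} {x : ι → MvPolynomial τ K}
    (hx : ∀ i : ℕ, (fun j => homogeneousComponent i (x j)) ∈ M) (r : MvPolynomial τ K) (i : ℕ) :
    (fun j => homogeneousComponent i (r * x j)) ∈ M := by
  induction r using MvPolynomial.induction_on generalizing i with
  | C c =>
    simp only [homogeneousComponent_C_mul]
    exact M.smul_mem (C c) (hx i)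
  | add p q hp hq =>
    simp only [add_mul, map_add]
    exact M.add_mem (hp i) (hq i)
  | mul_X p v hp =>
    simp only [mul_comm p (X v), mul_assoc]
    cases i with
    | zero =>
      simp only [homogeneousComponent_X_mul_zero]
      exact M.zero_mem
    | succ i =>
      simp only [homogeneousComponent_X_mul_succ]
      exact M.smul_mem (X v) (hp i)

theorem isGradedSubmodule_homogenizeModule [Fintype ι]
    (M : Submodule (MvPolynomial σ K) (ι → MvPolynomial σ K)) :
    IsGradedSubmodule (homogenizeModule M) := by
  intro x hx
  induction hx using Submodule.span_induction with
  | mem x hx =>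
    obtain ⟨m, hm, rfl⟩ := hx
    intro i
    have h : ∀ j, homogenizeTuple m j ∈ homogeneousSubmodule (Option σ) K (tupleDegree m) :=
      fun j => isHomogeneous_homogenizeTo _ _
    by_cases hi : i = tupleDegree m
    · simp only [homogeneousComponent_of_mem (h _), if_pos hi]
      exact Submodule.subset_span ⟨m, hm, rfl⟩
    · simp only [homogeneousComponent_of_mem (h _), if_neg hi]
      exact Submodule.zero_mem _
  | zero =>
    intro i
    simp only [Pi.zero_apply, map_zero]
    exact Submodule.zero_mem _
  | add x y _ _ hx hy =>
    intro i
    simp only [Pi.add_apply, map_add]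
    exact Submodule.add_mem _ (hx i) (hy i)
  | smul r x _ hx => exact homogeneousComponent_smul_mem hx r

end Gradedness

/-! ### Dimension bounds for the image in `S/fS`. -/

section Dimensions

variable {K : Type*} [Field K]

theorem finrank_restrictTotalDegree (n m : ℕ) :
    Module.finrank K (restrictTotalDegree (Fin n) K m) = (n + m).choose n := by
  classical
  have hcard : Nat.card {s : Fin n →₀ ℕ | (s.sum fun _ e => e) ≤ m} = (n + m).choose n := by
    have hset : {s : Fin n →₀ ℕ | (s.sum fun _ e => e) ≤ m} =
        ((Finset.range (m + 1)).biUnion fun k =>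
          (Finset.univ : Finset (Fin n)).finsuppAntidiag k : Finset (Fin n →₀ ℕ)) := by
      ext s
      simp [Finset.mem_finsuppAntidiag, Finsupp.sum_fintype]
    rw [hset, Nat.card_coe_set_eq, Set.ncard_coe_finset, Finset.card_biUnion]
    · simp only [Finset.card_finsuppAntidiag_nat_eq_multichoose, Finset.card_univ,
        Fintype.card_fin]
      rw [Nat.sum_range_multichoose, add_comm]
    · intro a _ b _ hab
      rw [Function.onFun, Finset.disjoint_left]
      intro s ha hb
      rw [Finset.mem_finsuppAntidiag] at ha hb
      exact hab (ha.1.symm.trans hb.1)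
  rw [← hcard]
  exact Module.finrank_eq_nat_card_basis (basisRestrictSupport K _)

theorem finrank_map_add_finrank_inf_ker {E F : Type*} [AddCommGroup E] [Module K E]
    [AddCommGroup F] [Module K F] (g : E →ₗ[K] F) (V : Submodule K E) [FiniteDimensional K V] :
    Module.finrank K (V.map g) + Module.finrank K ↥(V ⊓ LinearMap.ker g) = Module.finrank K V := by
  have h := LinearMap.finrank_range_add_finrank_ker (g.domRestrict V)
  rw [LinearMap.range_domRestrict, LinearMap.ker_domRestrict] at h
  rw [← h]
  congr 1
  have h2 : (V ⊓ LinearMap.ker g) = ((LinearMap.ker g).comap V.subtype).map V.subtype := by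
    rw [Submodule.map_comap_subtype]
  rw [h2]
  exact (Submodule.equivMapOfInjective _ V.injective_subtype _).finrank_eq.symm

/-- The quotient map `S → S / fS` as a `K`-linear map. -/
def quotientMap {σ : Type*} (f : MvPolynomial σ K) :
    MvPolynomial σ K →ₗ[K] (MvPolynomial σ K ⧸ Ideal.span {f}) :=
  (Ideal.Quotient.mkₐ K (Ideal.span {f})).toLinearMap

theorem quotientMap_eq_zero_iff {σ : Type*} {f p : MvPolynomial σ K} :
    quotientMap f p = 0 ↔ f ∣ p := by
  rw [← Ideal.mem_span_singleton]
  exact Ideal.Quotient.eq_zero_iff_mem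

/-- Degrees add in a domain, so multiples of `f` of degree at most `m` are `f` times polynomials of
degree at most `m - deg f`. The case split is needed since truncated subtraction would give `1` for
`m < deg f`. -/
theorem finrank_restrictTotalDegree_inf_ker {n : ℕ} {f : MvPolynomial (Fin n) K} (hf : f ≠ 0)
    (m : ℕ) :
    Module.finrank K ↥(restrictTotalDegree (Fin n) K m ⊓ LinearMap.ker (quotientMap f)) =
      if f.totalDegree ≤ m then (n + (m - f.totalDegree)).choose n else 0 := by
  split_ifs with h
  · have hinj : Function.Injective (LinearMap.mulLeft K f) :=
      fun a b hab => mul_left_cancel₀ hf hab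
    have : restrictTotalDegree (Fin n) K m ⊓ LinearMap.ker (quotientMap f) =
        (restrictTotalDegree (Fin n) K (m - f.totalDegree)).map (LinearMap.mulLeft K f) := by
      ext p
      simp only [Submodule.mem_inf, mem_restrictTotalDegree, LinearMap.mem_ker,
        quotientMap_eq_zero_iff, Submodule.mem_map, LinearMap.mulLeft_apply]
      constructor
      · rintro ⟨hp, q, rfl⟩
        refine ⟨q, ?_, rfl⟩
        by_cases hq : q = 0
        · simp [hq]
        · rw [totalDegree_mul_of_isDomain hf hq] at hp
          omega
      · rintro ⟨q, hq, rfl⟩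
        refine ⟨(totalDegree_mul f q).trans (by omega), Dvd.intro q rfl⟩
    rw [this, ← finrank_restrictTotalDegree (K := K)]
    exact (Submodule.equivMapOfInjective _ hinj _).finrank_eq.symm
  · have : restrictTotalDegree (Fin n) K m ⊓ LinearMap.ker (quotientMap f) = ⊥ := by
      rw [eq_bot_iff]
      rintro p ⟨hp, hfp⟩
      rw [SetLike.mem_coe, mem_restrictTotalDegree] at hp
      rw [SetLike.mem_coe, LinearMap.mem_ker, quotientMap_eq_zero_iff] at hfp
      by_contra hne
      exact h ((totalDegree_le_of_dvd_of_isDomain hfp hne).trans hp)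
    rw [this, finrank_bot]

/-- Bounds for the affine Hilbert function of the solution module of a linear congruence
`∑ a_j w_j ≡ 0` modulo `f`. -/
theorem exists_finrank_boundedPart_add [Infinite K] {n : ℕ} {f : MvPolynomial (Fin n) K}
    (hf : f ≠ 0) {w : Fin n → MvPolynomial (Fin n) K}
    (hw : ∀ j, w j = 0 ∨ (w j).totalDegree + 1 ≤ f.totalDegree)
    (hwf : ∀ g, Irreducible g → g ∣ f → ∃ j, ¬ g ∣ w j)
    {M : Submodule (MvPolynomial (Fin n) K) (Fin n → MvPolynomial (Fin n) K)}
    (hM : ∀ a, a ∈ M ↔ f ∣ ∑ j, a j * w j) (i : ℕ) :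
    ∃ a : ℕ, a + Module.finrank K (boundedPart M i) = n * (n + i).choose n ∧
      (n + i).choose n ≤
        a + (if f.totalDegree ≤ i then (n + (i - f.totalDegree)).choose n else 0) ∧
      a + (if f.totalDegree ≤ i + (f.totalDegree - 1) then
          (n + (i + (f.totalDegree - 1) - f.totalDegree)).choose n else 0) ≤
        (n + (i + (f.totalDegree - 1))).choose n := by
  let J : (Fin n → restrictTotalDegree (Fin n) K i) →ₗ[K] (Fin n → MvPolynomial (Fin n) K) :=
    LinearMap.pi fun j => (Submodule.subtype _).comp (LinearMap.proj j)
  have hJ : Function.Injective J := fun a b h => funext fun j => Subtype.ext (congrFun h j)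
  let φ : (Fin n → MvPolynomial (Fin n) K) →ₗ[K] MvPolynomial (Fin n) K :=
    ∑ j, (LinearMap.mulRight K (w j)).comp (LinearMap.proj j)
  have hφ : ∀ a, φ a = ∑ j, a j * w j := fun a => by simp [φ]
  let ψ := (quotientMap f).comp (φ.comp J)
  have hψ : ∀ a, ψ a = quotientMap f (∑ j, (a j : MvPolynomial (Fin n) K) * w j) :=
    fun a => congrArg (quotientMap f) (hφ (J a))
  have hker : boundedPart M i = (LinearMap.ker ψ).map J := by
    ext a
    rw [mem_boundedPart, hM, Submodule.mem_map]
    constructor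
    · rintro ⟨h1, h2⟩
      refine ⟨fun j => ⟨a j, (mem_restrictTotalDegree _ _ _).2 (h2 j)⟩, ?_, rfl⟩
      rw [LinearMap.mem_ker, hψ]
      exact quotientMap_eq_zero_iff.2 h1
    · rintro ⟨b, hb, rfl⟩
      rw [LinearMap.mem_ker, hψ, quotientMap_eq_zero_iff] at hb
      exact ⟨hb, fun j => (mem_restrictTotalDegree _ _ _).1 (b j).2⟩
  -- The witness is the rank of `ψ : (S_{≤ i})^n → S/fS`, whose kernel is the bounded part of `M`.
  refine ⟨Module.finrank K (LinearMap.range ψ), ?_, ?_, ?_⟩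
  · have h := LinearMap.finrank_range_add_finrank_ker ψ
    rw [Module.finrank_pi_fintype] at h
    simp only [finrank_restrictTotalDegree, Finset.sum_const, Finset.card_univ, Fintype.card_fin,
      smul_eq_mul] at h
    rw [← h, hker, (Submodule.equivMapOfInjective J hJ _).finrank_eq.symm]
  -- Lower bound: on tuples `(c_j p)_j`, `ψ` is multiplication by a polynomial prime to `f`, with
  -- the same kernel as the quotient map.
  · obtain ⟨c, hc⟩ := exists_isRelPrime_sum hf hwf
    have h := finrank_map_add_finrank_inf_ker
      ((quotientMap f).comp (LinearMap.mulRight K (∑ j, C (c j) * w j)))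
      (restrictTotalDegree (Fin n) K i)
    have hk : LinearMap.ker ((quotientMap f).comp (LinearMap.mulRight K (∑ j, C (c j) * w j))) =
        LinearMap.ker (quotientMap f) := by
      ext p
      simp only [LinearMap.mem_ker, LinearMap.comp_apply, LinearMap.mulRight_apply,
        quotientMap_eq_zero_iff]
      exact ⟨fun h => hc.dvd_of_dvd_mul_right h, fun h => h.mul_right _⟩
    rw [hk, finrank_restrictTotalDegree_inf_ker hf, finrank_restrictTotalDegree] at h
    rw [← h]
    refine Nat.add_le_add_right (Submodule.finrank_mono ?_) _
    rintro _ ⟨p, hp, rfl⟩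
    refine ⟨fun j => c j • ⟨p, hp⟩, ?_⟩
    rw [hψ]
    refine congrArg (quotientMap f) ?_
    rw [LinearMap.mulRight_apply, Finset.mul_sum]
    refine Finset.sum_congr rfl fun j _ => ?_
    rw [Submodule.coe_smul, smul_eq_C_mul]
    ring
  -- Upper bound: the range of `ψ` is in the image of `S_{≤ i+d-1}`. If `d = 0`, the truncated `d -
  -- 1` is harmless because all `w j` vanish.
  · have h := finrank_map_add_finrank_inf_ker (quotientMap f)
      (restrictTotalDegree (Fin n) K (i + (f.totalDegree - 1)))
    rw [finrank_restrictTotalDegree_inf_ker hf, finrank_restrictTotalDegree] at h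
    rw [← h]
    refine Nat.add_le_add_right (Submodule.finrank_mono ?_) _
    rintro _ ⟨b, rfl⟩
    refine ⟨_, ?_, (hψ b).symm⟩
    refine Submodule.sum_mem _ fun j _ => (mem_restrictTotalDegree _ _ _).2 ?_
    rcases hw j with h0 | h0
    · simp [h0]
    · have h1 := (mem_restrictTotalDegree _ _ _).1 (b j).2
      exact (totalDegree_mul _ _).trans (by omega)

end Dimensions

/-! ### Extraction of the derivative at `1` from the bounds. -/

section ChiComputation

theorem one_sub_X_pow_mul_mk_choose (n : ℕ) :
    (1 - PowerSeries.X) ^ (n + 1) * PowerSeries.mk (fun i => ((n + i).choose n : ℤ)) = 1 := by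
  rw [mul_comm, PowerSeries.mk_add_choose_mul_one_sub_pow_eq_one]

/-- The derivative at `1` of the Hilbert numerator is `d` when the Hilbert function of the quotient
lies between those of complete intersections of codimension one and degree `d`. -/
theorem eval_one_derivative_eq_of_bounds {n d : ℕ} {P : Polynomial ℤ} {H : ℕ → ℕ}
    (hP : (P : PowerSeries ℤ) =
      (1 - PowerSeries.X) ^ (n + 1) * PowerSeries.mk fun i => (H i : ℤ))
    (hH : ∀ i, ∃ a : ℕ, a + H i = n * (n + i).choose n ∧
      (n + i).choose n ≤ a + (if d ≤ i then (n + (i - d)).choose n else 0) ∧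
      a + (if d ≤ i + (d - 1) then (n + (i + (d - 1) - d)).choose n else 0) ≤
        (n + (i + (d - 1))).choose n) :
    (Polynomial.derivative P).eval 1 = d := by
  set R : PowerSeries ℤ := PowerSeries.mk fun i => ((n + i).choose n : ℤ) with hR
  set Q : PowerSeries ℤ := PowerSeries.mk fun i => (H i : ℤ) with hQ
  have hRinv : (1 - PowerSeries.X) ^ (n + 1) * R = 1 := one_sub_X_pow_mul_mk_choose n
  have hshift : ∀ i, PowerSeries.coeff i (PowerSeries.X ^ d * R) =
      ((if d ≤ i then (n + (i - d)).choose n else 0 : ℕ) : ℤ) := by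
    intro i
    rw [PowerSeries.coeff_X_pow_mul', hR, PowerSeries.coeff_mk]
    split_ifs <;> simp
  have hcoeff : ∀ i, PowerSeries.coeff i ((n : PowerSeries ℤ) * R - Q) =
      n * ((n + i).choose n : ℤ) - H i := by
    intro i
    rw [map_sub, ← map_natCast (PowerSeries.C (R := ℤ)) n, PowerSeries.coeff_C_mul, hR, hQ,
      PowerSeries.coeff_mk, PowerSeries.coeff_mk]
  -- Here `n R - Q` is the generating series of the codimensions `a_i`, with numerator `n - P`, and
  -- `R - X^d R` has numerator `1 - X^d`.
  have hlower : ((((n : Polynomial ℤ) - P) - (1 - Polynomial.X ^ d) : Polynomial ℤ) :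
      PowerSeries ℤ) =
      (1 - PowerSeries.X) ^ (n + 1) * (((n : PowerSeries ℤ) * R - Q) -
        (R - PowerSeries.X ^ d * R)) := by
    have hn : ((n : Polynomial ℤ) : PowerSeries ℤ) = n :=
      map_natCast (Polynomial.coeToPowerSeries.ringHom (R := ℤ)) n
    simp only [Polynomial.coe_sub, Polynomial.coe_pow, Polynomial.coe_X, Polynomial.coe_one, hn, hP]
    linear_combination (1 - PowerSeries.X ^ d - (n : PowerSeries ℤ)) * hRinv
  have hupper : (((1 - Polynomial.X ^ d) - Polynomial.X ^ (d - 1) * ((n : Polynomial ℤ) - P) :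
      Polynomial ℤ) : PowerSeries ℤ) =
      (1 - PowerSeries.X) ^ (n + 1) * ((R - PowerSeries.X ^ d * R) -
        PowerSeries.X ^ (d - 1) * ((n : PowerSeries ℤ) * R - Q)) := by
    have hn : ((n : Polynomial ℤ) : PowerSeries ℤ) = n :=
      map_natCast (Polynomial.coeToPowerSeries.ringHom (R := ℤ)) n
    simp only [Polynomial.coe_sub, Polynomial.coe_mul, Polynomial.coe_pow, Polynomial.coe_X,
      Polynomial.coe_one, hn, hP]
    linear_combination (PowerSeries.X ^ (d - 1) * (n : PowerSeries ℤ) - 1 +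
      PowerSeries.X ^ d) * hRinv
  have hlower0 : ∀ i, 0 ≤ PowerSeries.coeff i (((n : PowerSeries ℤ) * R - Q) -
      (R - PowerSeries.X ^ d * R)) := by
    intro i
    obtain ⟨a, h1, h2, -⟩ := hH i
    rw [map_sub, map_sub _ R, hcoeff, hshift, hR, PowerSeries.coeff_mk]
    zify at h1 h2 ⊢
    linarith
  have hupper0 : ∀ i, 0 ≤ PowerSeries.coeff i ((R - PowerSeries.X ^ d * R) -
      PowerSeries.X ^ (d - 1) * ((n : PowerSeries ℤ) * R - Q)) := by
    intro k
    rw [map_sub, map_sub _ R, hshift, PowerSeries.coeff_X_pow_mul', hcoeff, hR,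
      PowerSeries.coeff_mk]
    by_cases hk : d - 1 ≤ k
    · obtain ⟨i, rfl⟩ := Nat.exists_eq_add_of_le' hk
      obtain ⟨a, h1, -, h3⟩ := hH i
      rw [if_pos hk, Nat.add_sub_cancel]
      zify at h1 h3 ⊢
      linarith
    -- Below degree `d - 1` both shifted terms vanish, leaving a binomial coefficient.
    · rw [if_neg hk, if_neg (by omega)]
      simp
  have hl := fun t h0 h1 => aeval_nonneg_of_coe_eq_one_sub_pow_mul hlower hlower0 (t := t)
    (le_of_lt h0) h1
  have hu := fun t h0 h1 => aeval_nonneg_of_coe_eq_one_sub_pow_mul hupper hupper0 (t := t)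
    (le_of_lt h0) h1
  have hl1 := eval_one_nonneg_of_aeval_nonneg hl
  have hu1 := eval_one_nonneg_of_aeval_nonneg hu
  have hPn : P.eval 1 = n := by
    simp at hl1 hu1
    linarith
  have hl2 := eval_one_derivative_nonpos_of_aeval_nonneg hl (by simp [hPn])
  -- The factor `X ^ (d - 1)` does not affect the derivative at `1`, since `n - P` vanishes there.
  have hu2 := eval_one_derivative_nonpos_of_aeval_nonneg hu (by simp [hPn])
  have hX : (Polynomial.derivative (Polynomial.X ^ d : Polynomial ℤ)).eval 1 = d := by
    simp [Polynomial.derivative_X_pow]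
  simp [hPn, hX] at hl2 hu2
  linarith

end ChiComputation

end

end LogDer

/-! ### The main theorem. -/

open MvPolynomial LogDer

theorem mainTheorem3 {K : Type*} [Field K] [CharZero K] (n : ℕ)
    (f : MvPolynomial (Fin n) K) (hf : f ≠ 0) :
    LogDer.IsGradedSubmodule (LogDer.logDerHomogenized f) ∧
    (∀ i : ℕ, FiniteDimensional K (LogDer.gradedPart (LogDer.logDerHomogenized f) i)) ∧
    (∃ P : Polynomial ℤ, LogDer.IsHilbertNumerator (LogDer.logDerHomogenized f) P) ∧
    LogDer.chi (LogDer.logDerHomogenized f) = (f.totalDegree : ℤ) := by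
  have hgraded : IsGradedSubmodule (logDerHomogenized f) := isGradedSubmodule_homogenizeModule _
  obtain ⟨P, hP⟩ := exists_isHilbertNumerator hgraded
  refine ⟨hgraded, fun i => finiteDimensional_gradedPart _ i, ⟨P, hP⟩, ?_⟩
  rw [hP.chi_eq]
  obtain ⟨w, hw, hwf, hδ⟩ := exists_mem_logDer_iff_dvd f hf
  have hmem : ∀ a : Fin n → MvPolynomial (Fin n) K,
      a ∈ (logDer f).map (derCoords : _ ≃ₗ[MvPolynomial (Fin n) K]
        (Fin n → MvPolynomial (Fin n) K)).toLinearMap ↔ f ∣ ∑ j, a j * w j := by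
    intro a
    rw [Submodule.mem_map]
    constructor
    · rintro ⟨δ, h, rfl⟩
      exact (hδ δ).1 h
    · intro h
      have ha := derCoords.apply_symm_apply a
      refine ⟨derCoords.symm a, (hδ _).2 ?_, ha⟩
      have hX : ∀ j, (derCoords.symm a) (X j) = a j := fun j => congrFun ha j
      simpa only [hX] using h
  refine eval_one_derivative_eq_of_bounds (n := n)
    (H := fun i => Module.finrank K (gradedPart (logDerHomogenized f) i)) ?_ fun i => ?_
  · have hcard : Fintype.card (Option (Fin n)) = n + 1 := by simp
    rw [← hcard]
    exact hP
  · have h := exists_finrank_boundedPart_add hf hw hwf hmem i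
    rw [← finrank_gradedPart_homogenizeModule] at h
    exact h
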